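/- Let $\Bbbk$ be a field of characteristic $0$ and $S=\Bbbk[x_1,x_2,x_3,x_4]$, with the lexicographic order given by $x_1\succ x_2\succ x_3\succ x_4$. A point $\mathbf a\in\mathbb A_{\Bbbk}^{20}$ gives the coefficients of two quadratic forms $f_1,f_2\in S$ (each a $\Bbbk$-linear combination of the ten monomials of degree $2$), and thereby an ideal $I_{\mathbf a}=(f_1,f_2)$. Let $U\subset\mathbb A_{\Bbbk}^{20}$ be the set of points $\mathbf a$ with generic Hilbert series, that is, such that for every $e\ge 0$ the dimension $\dim_{\Bbbk}(I_{\mathbf a})_e$ is the largest among all $\dim_{\Bbbk}(I_{\mathbf b})_e$, $\mathbf b\in\mathbb A_{\Bbbk}^{20}$ (equivalently, $\dim_{\Bbbk}(S/I_{\mathbf a})_e$ is the smallest). A monomial ideal $J\subset S$ is called lexsegment if, for every monomial $m\in J$, each monomial $m'$ with $\deg m'=\deg m$ and $m\preceq m'$ also lies in $J$. Then there is no point $\mathbf a\in U$ for which the initial ideal $\operatorname{in}_{\preceq}(I_{\mathbf a})$ with respect to the lexicographic order is a lexsegment ideal. -/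

import Mathlib

open MvPolynomial
open scoped MonomialOrder

noncomputable section

namespace GenericIdeals

variable {k : Type*} [Field k] {n s : ℕ}

/-- The points of the affine space `𝔸_k^N`, where `N = r_1 + ⋯ + r_s` and `r_i` is the number of
monomials of degree `d i` in `n` variables: a point consists of one scalar for each `i` and each
monomial of degree `d i` (given by its exponent vector). -/
abbrev ParamSpace (k : Type*) (n : ℕ) {s : ℕ} (d : Fin s → ℕ) : Type _ :=
  (i : Fin s) → ↥((Finset.univ : Finset (Fin n)).finsuppAntidiag (d i)) → k

/-- The form `f_i` of degree `d i` whose coefficients are the coordinates of the point `a`. -/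
def form {d : Fin s → ℕ} (a : ParamSpace k n d) (i : Fin s) : MvPolynomial (Fin n) k :=
  ∑ m : ↥((Finset.univ : Finset (Fin n)).finsuppAntidiag (d i)), monomial m.1 (a i m)

/-- The ideal `I = (f_1, …, f_s)` corresponding to the point `a`. -/
def idealOfPoint {d : Fin s → ℕ} (a : ParamSpace k n d) : Ideal (MvPolynomial (Fin n) k) :=
  Ideal.span (Set.range (form a))

/-- The degree `e` part `I_e` of an ideal `I`, as a `k`-subspace of the polynomial ring. -/
def degreePart (I : Ideal (MvPolynomial (Fin n) k)) (e : ℕ) :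
    Submodule k (MvPolynomial (Fin n) k) :=
  I.restrictScalars k ⊓ homogeneousSubmodule (Fin n) k e

/-- The set `U` of points `a` for which `dim I_e` is as large as possible in every degree `e`,
that is, for which the Hilbert function of `S/I` is the minimal (generic) one. Over an infinite
field, the points with `dim I_e` maximal for one given `e` are those at which some nonzero maximal
minor of the family of all multiples `τ F_i` of degree `e` of the generic forms does not vanish. -/
def U (k : Type*) [Field k] (n : ℕ) {s : ℕ} (d : Fin s → ℕ) : Set (ParamSpace k n d) :=
  {a | ∀ (e : ℕ) (b : ParamSpace k n d),
    Module.finrank k (degreePart (idealOfPoint b) e) ≤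
      Module.finrank k (degreePart (idealOfPoint a) e)}

/-- The initial ideal of `I` with respect to a monomial order. -/
def initialIdeal (ord : MonomialOrder (Fin n)) (I : Ideal (MvPolynomial (Fin n) k)) :
    Ideal (MvPolynomial (Fin n) k) :=
  Ideal.span (ord.leadingTerm '' (I : Set (MvPolynomial (Fin n) k)))

/-- An ideal generated by monomials. -/
def IsMonomialIdeal (J : Ideal (MvPolynomial (Fin n) k)) : Prop :=
  ∃ A : Set (Fin n →₀ ℕ), J = Ideal.span ((fun m => monomial m (1 : k)) '' A)

/-- Lexsegment ideals. In `MonomialOrder.lex` on `Fin n`, the variables are ordered by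
`X 0 > X 1 > ⋯ > X (n - 1)`. -/
def IsLexsegment (J : Ideal (MvPolynomial (Fin n) k)) : Prop :=
  IsMonomialIdeal J ∧
    ∀ m m' : Fin n →₀ ℕ, monomial m (1 : k) ∈ J → m.degree = m'.degree →
      m ≼[MonomialOrder.lex] m' → monomial m' (1 : k) ∈ J

end GenericIdeals

end

/-!
Two quadrics `f₀`, `f₁` have the generic Hilbert function only if they have few relations: since
`(X 0 ^ 2, X 1 ^ 2)` has at least 19 independent quartics and the quartics of `(f₀, f₁)` are the
combinations `A f₀ + B f₁` with `(A, B)` in a space of dimension 20, the only quadratic relations at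
a point of `U` are the multiples of the Koszul relation `(f₁, -f₀)` (`finrank_ker_formCombination_le`,
`eq_zero_of_relation`).

Elimination of `X 0` contradicts this when the initial ideal `J` is lexsegment. Eliminating `X 0` by
the resultant gives a quartic `A f₀ + B f₁` of the ideal that is free of `X 0`. If it were nonzero,
its leading monomial would force all twenty quartic monomials divisible by `X 0` into `J`, so the
ideal would have at least 21 independent quartics, while there are at most 20
(`eq_zero_of_mem_lowerVars`). Hence the resultant vanishes, and `(A, B)` is a relation. Neither `A`
nor `B` has a term in `X 0 ^ 2`, while one of the quadrics does
(`exists_coeff_single_zero_ne_zero`); so `(A, B)` is not a nonzero multiple of the Koszul relation,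
and `A = B = 0`. From this `f₀` and `f₁` come out proportional, which again is a relation too many.
-/

namespace GenericIdeals

/-! ### Dimensions of the degree parts and leading monomials -/

section HilbertFunction

variable {k : Type*} [Field k] {n : ℕ}

instance (e : ℕ) : Module.Finite k (homogeneousSubmodule (Fin n) k e) :=
  Module.Finite.iff_fg.mpr (homogeneousSubmodule_fg (Fin n) k e)

instance (I : Ideal (MvPolynomial (Fin n) k)) (e : ℕ) : Module.Finite k (degreePart I e) :=
  Submodule.finiteDimensional_of_le (inf_le_right : _ ≤ homogeneousSubmodule (Fin n) k e)

theorem mem_degreePart {I : Ideal (MvPolynomial (Fin n) k)} {e : ℕ} {f : MvPolynomial (Fin n) k} :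
    f ∈ degreePart I e ↔ f ∈ I ∧ f.IsHomogeneous e := by
  simp [degreePart]

theorem mem_antidiag_iff {e : ℕ} {m : Fin n →₀ ℕ} :
    m ∈ (Finset.univ : Finset (Fin n)).finsuppAntidiag e ↔ m.degree = e := by
  simp [Finsupp.degree_eq_sum]

theorem finrank_homogeneousSubmodule (e : ℕ) :
    Module.finrank k (homogeneousSubmodule (Fin n) k e) = (n + e - 1).choose e := by
  have hset : {d : Fin n →₀ ℕ | d.degree = e} =
      ((Finset.univ : Finset (Fin n)).finsuppAntidiag e : Set (Fin n →₀ ℕ)) := by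
    ext m
    exact mem_antidiag_iff.symm
  rw [homogeneousSubmodule_eq_finsupp_supported, hset,
    (AddMonoidAlgebra.supportedEquivFinsupp (R := k) (S := k) _).finrank_eq]
  simp [Finset.card_finsuppAntidiag_nat_eq_choose]

/-- Polynomials with distinct leading exponents are linearly independent, so the number of leading
exponents in degree `e` bounds the dimension of `I_e` from below. -/
theorem card_le_finrank_degreePart (ord : MonomialOrder (Fin n))
    {I : Ideal (MvPolynomial (Fin n) k)} {e : ℕ} (T : Finset (Fin n →₀ ℕ))
    (hT : ∀ m ∈ T, ∃ f ∈ degreePart I e, f ≠ 0 ∧ ord.degree f = m) :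
    T.card ≤ Module.finrank k (degreePart I e) := by
  choose! f hf hf0 hdeg using hT
  let F : T → degreePart I e := fun m => ⟨f m, hf m m.2⟩
  have hF : LinearIndependent k F := by
    rw [Fintype.linearIndependent_iff]
    intro c hc
    classical
    by_contra! hne
    obtain ⟨i, hi⟩ := hne
    obtain ⟨j, hj, hmax⟩ := Finset.exists_max_image (Finset.univ.filter fun t : T => c t ≠ 0)
      (fun t => ord.toSyn t.1) ⟨i, by simpa using hi⟩
    have hcoeff := congrArg (fun g : degreePart I e => coeff j.1 g.1) hc
    simp only [F, AddSubmonoidClass.coe_finsetSum, Submodule.coe_smul, coeff_sum, coeff_smul,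
      smul_eq_mul, ZeroMemClass.coe_zero, coeff_zero] at hcoeff
    -- only the summand `j` contributes, since `j` is the largest exponent with `c j ≠ 0`
    rw [Finset.sum_eq_single j] at hcoeff
    · refine (mul_ne_zero (by simpa using hj) ?_) hcoeff
      have := ord.coeff_degree_ne_zero_iff.mpr (hf0 j j.2)
      rwa [hdeg j j.2] at this
    · intro t _ htj
      by_cases hct : c t = 0
      · simp [hct]
      · rw [ord.coeff_eq_zero_of_lt, mul_zero]
        rw [hdeg t t.2]
        refine lt_of_le_of_ne (hmax t (by simpa using hct)) fun h => htj ?_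
        exact Subtype.ext (ord.toSyn.injective h)
    · simp
  simpa using hF.fintype_card_le_finrank

end HilbertFunction

/-! ### Initial ideals of homogeneous ideals -/

section InitialIdeal

variable {k : Type*} [Field k] {n s : ℕ}

attribute [local instance] MvPolynomial.gradedAlgebra

theorem form_isHomogeneous {d : Fin s → ℕ} (a : ParamSpace k n d) (i : Fin s) :
    (form a i).IsHomogeneous (d i) :=
  IsHomogeneous.sum _ _ _ fun m _ => isHomogeneous_monomial _ (mem_antidiag_iff.mp m.2)

theorem form_mem_idealOfPoint {d : Fin s → ℕ} (a : ParamSpace k n d) (i : Fin s) :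
    form a i ∈ idealOfPoint a :=
  Ideal.subset_span ⟨i, rfl⟩

theorem idealOfPoint_isHomogeneous {d : Fin s → ℕ} (a : ParamSpace k n d) :
    (idealOfPoint a).IsHomogeneous (homogeneousSubmodule (Fin n) k) := by
  refine Ideal.homogeneous_span _ _ ?_
  rintro _ ⟨i, rfl⟩
  exact ⟨d i, form_isHomogeneous a i⟩

theorem homogeneousComponent_add_mul {f : MvPolynomial (Fin n) k} {d : ℕ} (hf : f.IsHomogeneous d)
    (g : MvPolynomial (Fin n) k) (e : ℕ) :
    homogeneousComponent (e + d) (g * f) = homogeneousComponent e g * f := by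
  have := DirectSum.coe_decompose_mul_add_of_right_mem (homogeneousSubmodule (Fin n) k)
    (a := g) (i := e) ((mem_homogeneousSubmodule d f).mpr hf)
  rwa [← decomposition.decompose'_apply, ← decomposition.decompose'_apply]

/-- Every monomial of the initial ideal is the leading monomial of a form of its degree in the
ideal. -/
theorem exists_degree_eq_of_monomial_mem_initialIdeal (ord : MonomialOrder (Fin n))
    {d : Fin s → ℕ} {a : ParamSpace k n d} {m : Fin n →₀ ℕ}
    (hm : monomial m (1 : k) ∈ initialIdeal ord (idealOfPoint a)) :
    ∃ f ∈ degreePart (idealOfPoint a) m.degree, f ≠ 0 ∧ ord.degree f = m := by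
  have hle : initialIdeal ord (idealOfPoint a) ≤ Ideal.span ((fun m => monomial m (1 : k)) ''
      (ord.degree '' {f | f ∈ idealOfPoint a ∧ f ≠ 0})) := by
    refine Ideal.span_le.mpr ?_
    rintro _ ⟨f, hf, rfl⟩
    by_cases hf0 : f = 0
    · simp [hf0]
    · refine mem_ideal_span_monomial_image.mpr fun x hx => ⟨ord.degree f, ⟨f, ⟨hf, hf0⟩, rfl⟩, ?_⟩
      rw [MonomialOrder.support_leadingTerm' hf0, Finset.mem_singleton] at hx
      exact hx.ge
  obtain ⟨_, ⟨f, ⟨hf, hf0⟩, rfl⟩, hfm⟩ := mem_ideal_span_monomial_image.mp (hle hm) m (by simp)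
  have hx0 : monomial (m - ord.degree f) (1 : k) ≠ 0 := by simp
  set g := monomial (m - ord.degree f) (1 : k) * f with hg
  have hg0 : g ≠ 0 := mul_ne_zero hx0 hf0
  have hgdeg : ord.degree g = m := by
    classical
    rw [hg, ord.degree_mul hx0 hf0, ord.degree_monomial, if_neg one_ne_zero,
      tsub_add_cancel_of_le hfm]
  have hcoeff : coeff m (homogeneousComponent m.degree g) ≠ 0 := by
    rw [coeff_homogeneousComponent, if_pos rfl, ← hgdeg]
    exact ord.coeff_degree_ne_zero_iff.mpr hg0
  refine ⟨homogeneousComponent m.degree g, mem_degreePart.mpr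
    ⟨homogeneousComponent_mem_of_mem (idealOfPoint_isHomogeneous a) (Ideal.mul_mem_left _ _ hf) _,
      homogeneousComponent_isHomogeneous _ _⟩, fun h => hcoeff (by simp [h]), ?_⟩
  refine ord.toSyn.injective (le_antisymm ?_ (ord.le_degree (mem_support_iff.mpr hcoeff)))
  refine ord.degree_le_iff.mpr fun c hc => ?_
  rw [support_homogeneousComponent, Finset.mem_filter] at hc
  exact (ord.le_degree hc.1).trans_eq (by rw [hgdeg])

/-- The leading monomial of a nonzero element of an ideal lies in the initial ideal. -/
theorem monomial_degree_mem_initialIdeal (ord : MonomialOrder (Fin n))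
    {I : Ideal (MvPolynomial (Fin n) k)} {f : MvPolynomial (Fin n) k} (hf : f ∈ I) (hf0 : f ≠ 0) :
    monomial (ord.degree f) (1 : k) ∈ initialIdeal ord I := by
  have h : ord.leadingTerm f ∈ initialIdeal ord I := Ideal.subset_span ⟨f, hf, rfl⟩
  have := Ideal.mul_mem_left _ (C (ord.leadingCoeff f)⁻¹) h
  rwa [MonomialOrder.leadingTerm, C_mul_monomial,
    inv_mul_cancel₀ (ord.leadingCoeff_ne_zero_iff.mpr hf0)] at this

end InitialIdeal

/-! ### Forms in an ideal with two generators -/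

section TwoQuadrics

variable {k : Type*} [Field k] {n : ℕ}

/-- The map `(A, B) ↦ A f₀ + B f₁` from pairs of forms of degree `e` to polynomials. -/
noncomputable def formCombination {d : Fin 2 → ℕ} (a : ParamSpace k n d) (e : ℕ) :
    homogeneousSubmodule (Fin n) k e × homogeneousSubmodule (Fin n) k e →ₗ[k]
      MvPolynomial (Fin n) k :=
  ((LinearMap.mulRight k (form a 0)).comp (Submodule.subtype _)).coprod
    ((LinearMap.mulRight k (form a 1)).comp (Submodule.subtype _))

theorem formCombination_apply {d : Fin 2 → ℕ} (a : ParamSpace k n d) (e : ℕ)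
    (p : homogeneousSubmodule (Fin n) k e × homogeneousSubmodule (Fin n) k e) :
    formCombination a e p = p.1.1 * form a 0 + p.2.1 * form a 1 := by
  simp [formCombination]

/-- The cofactors of a form of degree `e + d` in the ideal of two forms of degree `d` can be taken
homogeneous of degree `e`. -/
theorem degreePart_le_range_formCombination (d e : ℕ) (a : ParamSpace k n (fun _ : Fin 2 => d)) :
    degreePart (idealOfPoint a) (e + d) ≤ LinearMap.range (formCombination a e) := by
  intro f hf
  obtain ⟨hfI, hfh⟩ := mem_degreePart.mp hf
  obtain ⟨c, hc⟩ := (Ideal.mem_span_range_iff_exists_fun).mp hfI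
  refine ⟨(⟨_, homogeneousComponent_mem e (c 0)⟩, ⟨_, homogeneousComponent_mem e (c 1)⟩), ?_⟩
  rw [formCombination_apply, ← homogeneousComponent_eq_self hfh, ← hc, Fin.sum_univ_two, map_add,
    homogeneousComponent_add_mul (form_isHomogeneous a 0),
    homogeneousComponent_add_mul (form_isHomogeneous a 1)]

end TwoQuadrics

/-! ### The lexicographically largest variable -/

section LeadingVariable

variable {k : Type*} [Field k] {n : ℕ}

theorem lex_lt_of_apply_zero_lt {m m' : Fin (n + 1) →₀ ℕ} (h : m 0 < m' 0) :
    m ≺[MonomialOrder.lex] m' := by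
  rw [MonomialOrder.lex_lt_iff, Finsupp.Lex.lt_iff]
  exact ⟨0, fun j hj => absurd hj (Fin.not_lt_zero j), h⟩

theorem lex_le_single_zero {m : Fin (n + 1) →₀ ℕ} {e : ℕ} (hm : m.degree = e) :
    m ≼[MonomialOrder.lex] Finsupp.single 0 e := by
  by_cases h : m 0 < e
  · exact (lex_lt_of_apply_zero_lt (by simpa using h)).le
  · refine le_of_eq (congrArg _ ?_)
    have hsum : m 0 + ∑ i : Fin n, m i.succ = e := by
      rw [← hm, Finsupp.degree_eq_sum, Fin.sum_univ_succ]
    have hzero : ∑ i : Fin n, m i.succ = 0 := by omega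
    ext j
    refine Fin.cases ?_ (fun i => ?_) j
    · simp; omega
    · simpa using (Finset.sum_eq_zero_iff.mp hzero) i (Finset.mem_univ i)

/-- The ideal `(X 1, …, X n)` of the projective point at which all variables but `X 0` vanish. -/
noncomputable abbrev lowerVarsIdeal (k : Type*) [Field k] (n : ℕ) :
    Ideal (MvPolynomial (Fin (n + 1)) k) :=
  Ideal.span (X '' {i | i ≠ 0})

theorem coeff_single_zero_of_mem {f : MvPolynomial (Fin (n + 1)) k} (hf : f ∈ lowerVarsIdeal k n)
    (e : ℕ) : coeff (Finsupp.single 0 e) f = 0 := by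
  by_contra h
  obtain ⟨i, hi, hi'⟩ := mem_ideal_span_X_image.mp hf _ (mem_support_iff.mpr h)
  exact hi' (Finsupp.single_eq_of_ne hi)

/-- The polynomials in the variables other than `X 0`. -/
noncomputable abbrev lowerVars (k : Type*) [Field k] (n : ℕ) :
    Subalgebra k (MvPolynomial (Fin (n + 1)) k) :=
  supported k {i | i ≠ 0}

theorem mem_lowerVars_iff {f : MvPolynomial (Fin (n + 1)) k} :
    f ∈ lowerVars k n ↔ ∀ m ∈ f.support, m 0 = 0 := by
  rw [mem_supported]
  constructor
  · intro h m hm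
    by_contra h0
    exact h ((mem_vars_iff_mem_support 0).mpr ⟨m, hm, by simpa using h0⟩) rfl
  · rintro h i hi rfl
    obtain ⟨m, hm, hi⟩ := (mem_vars_iff_mem_support 0).mp hi
    exact (Finsupp.mem_support_iff.mp hi) (h m hm)

theorem mem_lowerVarsIdeal_of_isHomogeneous {f : MvPolynomial (Fin (n + 1)) k} {d : ℕ}
    (hd : d ≠ 0) (hh : f.IsHomogeneous d) (hf : f ∈ lowerVars k n) : f ∈ lowerVarsIdeal k n := by
  refine mem_ideal_span_X_image.mpr fun m hm => ?_
  by_contra! h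
  have hm0 : m = 0 := by
    ext i
    by_cases hi : i = 0
    · rw [hi]; exact mem_lowerVars_iff.mp hf m hm
    · exact h i hi
  have := hh (mem_support_iff.mp hm)
  simp [hm0] at this
  exact hd this.symm

theorem exists_eq_X_zero_mul_add {f : MvPolynomial (Fin (n + 1)) k} {d : ℕ}
    (hf : f.IsHomogeneous (d + 1)) :
    ∃ g r, f = X 0 * g + r ∧ g.IsHomogeneous d ∧ r.IsHomogeneous (d + 1) ∧ r ∈ lowerVars k n := by
  refine ⟨f.divMonomial (Finsupp.single 0 1), f.modMonomial (Finsupp.single 0 1),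
    (divMonomial_add_modMonomial_single f 0).symm, ?_, ?_, ?_⟩
  · intro m hm
    rw [coeff_divMonomial] at hm
    have := hf hm
    simp only [map_add, Finsupp.weight_single] at this
    simp at this
    omega
  · intro m hm
    by_cases h : Finsupp.single 0 1 ≤ m
    · exact absurd (coeff_modMonomial_of_le f h) hm
    · rw [coeff_modMonomial_of_not_le f h] at hm
      exact hf hm
  · refine mem_lowerVars_iff.mpr fun m hm => ?_
    by_contra h
    refine mem_support_iff.mp hm (coeff_modMonomial_of_le f ?_)
    simpa [Nat.one_le_iff_ne_zero] using h

/-- A quadratic form as a quadratic polynomial in `X 0` over the polynomials in the other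
variables. -/
theorem exists_eq_quadratic_in_X_zero {f : MvPolynomial (Fin (n + 1)) k} (hf : f.IsHomogeneous 2) :
    ∃ l q, f = C (coeff (Finsupp.single 0 2) f) * X 0 ^ 2 + (l * X 0 + q) ∧
      l.IsHomogeneous 1 ∧ q.IsHomogeneous 2 ∧ l ∈ lowerVars k n ∧ q ∈ lowerVars k n := by
  obtain ⟨g, q, hfg, hg, hq, hq'⟩ := exists_eq_X_zero_mul_add hf
  obtain ⟨b, l, hgb, hb, hl, hl'⟩ := exists_eq_X_zero_mul_add hg
  have hbC := totalDegree_eq_zero_iff_eq_C.mp ((totalDegree_zero_iff_isHomogeneous _).mpr hb)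
  have heq : f = C (coeff 0 b) * X 0 ^ 2 + (l * X 0 + q) := by
    rw [← hbC, hfg, hgb]
    ring
  have hrest : l * X 0 + q ∈ lowerVarsIdeal k n :=
    add_mem (Ideal.mul_mem_right _ _ (mem_lowerVarsIdeal_of_isHomogeneous one_ne_zero hl hl'))
      (mem_lowerVarsIdeal_of_isHomogeneous two_ne_zero hq hq')
  have hcoeff : coeff (Finsupp.single 0 2) f = coeff 0 b := by
    rw [heq, coeff_add, coeff_single_zero_of_mem hrest, X_pow_eq_monomial, coeff_C_mul,
      coeff_monomial, if_pos rfl, mul_one, add_zero]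
  exact ⟨l, q, by rwa [hcoeff], hl, hq, hl', hq'⟩

end LeadingVariable

/-! ### Two quadrics in four variables -/

section TwoQuadricsInFourVariables

variable {k : Type*} [Field k]

theorem card_antidiag (e : ℕ) :
    ((Finset.univ : Finset (Fin 4)).finsuppAntidiag e).card = (4 + e - 1).choose e := by
  simp [Finset.card_finsuppAntidiag_nat_eq_choose]

/-- The witness is `(X 0 ^ 2, X 1 ^ 2)`, which contains the nineteen quartic monomials divisible by
`X 0 ^ 2` or `X 1 ^ 2`. -/
theorem exists_nineteen_le_finrank :
    ∃ b : ParamSpace k 4 (fun _ : Fin 2 => 2),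
      19 ≤ Module.finrank k (degreePart (idealOfPoint b) 4) := by
  classical
  let v : Fin 2 → Fin 4 := ![0, 1]
  let b : ParamSpace k 4 (fun _ : Fin 2 => 2) := fun i m =>
    if m.1 = Finsupp.single (v i) 2 then 1 else 0
  have hb (i : Fin 2) : form b i = monomial (Finsupp.single (v i) 2) (1 : k) := by
    have hmem : Finsupp.single (v i) 2 ∈ (Finset.univ : Finset (Fin 4)).finsuppAntidiag 2 :=
      mem_antidiag_iff.mpr (by simp)
    rw [form, Finset.sum_eq_single ⟨_, hmem⟩]
    · simp [b]
    · intro m _ hm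
      have : m.1 ≠ Finsupp.single (v i) 2 := fun h => hm (Subtype.ext h)
      simp [b, this]
    · simp
  let D := (Finset.univ : Finset (Fin 4)).finsuppAntidiag 2
  let T (i : Fin 2) : Finset (Fin 4 →₀ ℕ) := D.image (· + Finsupp.single (v i) 2)
  have hT (i : Fin 2) : (T i).card = 10 := by
    rw [Finset.card_image_of_injective _ (add_left_injective _), card_antidiag]
    rfl
  have hinter : (T 0 ∩ T 1).card ≤ 1 := by
    refine Finset.card_le_one_iff_subset_singleton.mpr
      ⟨Finsupp.single 0 2 + Finsupp.single 1 2, fun m hm => ?_⟩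
    simp only [T, Finset.mem_inter, Finset.mem_image] at hm
    obtain ⟨⟨p, hp, hpm⟩, q, hq, hqm⟩ := hm
    have hdeg := mem_antidiag_iff.mp hp
    have hpq := hpm.trans hqm.symm
    rw [Finset.mem_singleton, ← hpm, add_comm]
    congr 1
    have h1 : p 1 = q 1 + 2 := by simpa [v] using DFunLike.congr_fun hpq 1
    rw [Finsupp.degree_eq_sum, Fin.sum_univ_four] at hdeg
    ext j
    fin_cases j <;> simp <;> omega
  -- the count is `19 = 10 + 10 - 1`, by inclusion and exclusion
  refine ⟨b, ?_⟩
  have hcard := Finset.card_union_add_card_inter (T 0) (T 1)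
  rw [hT, hT] at hcard
  refine le_trans (by omega) (card_le_finrank_degreePart MonomialOrder.lex (T 0 ∪ T 1) ?_)
  intro m hm
  obtain ⟨i, hi⟩ : ∃ i, m ∈ T i := by
    rcases Finset.mem_union.mp hm with h | h
    exacts [⟨0, h⟩, ⟨1, h⟩]
  obtain ⟨p, hp, rfl⟩ := Finset.mem_image.mp hi
  refine ⟨monomial (p + Finsupp.single (v i) 2) 1, mem_degreePart.mpr ⟨?_, ?_⟩, by simp, ?_⟩
  · rw [← one_mul (1 : k), ← monomial_mul, ← hb]
    exact Ideal.mul_mem_left _ _ (form_mem_idealOfPoint b i)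
  · refine isHomogeneous_monomial _ ?_
    simp [mem_antidiag_iff.mp hp]
  · simp [MonomialOrder.degree_monomial]

variable {a : ParamSpace k 4 (fun _ : Fin 2 => 2)}

theorem nineteen_le_finrank_of_mem_U (ha : a ∈ U k 4 (fun _ : Fin 2 => 2)) :
    19 ≤ Module.finrank k (degreePart (idealOfPoint a) 4) := by
  obtain ⟨b, hb⟩ := exists_nineteen_le_finrank (k := k)
  exact hb.trans (ha 4 b)

theorem finrank_degreePart_four_le : Module.finrank k (degreePart (idealOfPoint a) 4) ≤ 20 := by
  refine (Submodule.finrank_mono (degreePart_le_range_formCombination 2 2 a)).trans ?_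
  refine (LinearMap.finrank_range_le _).trans ?_
  rw [Module.finrank_prod, finrank_homogeneousSubmodule]
  rfl

/-- At a point of `U` there is, up to scalars, at most one relation with quadratic coefficients. -/
theorem finrank_ker_formCombination_le (ha : a ∈ U k 4 (fun _ : Fin 2 => 2)) :
    Module.finrank k (LinearMap.ker (formCombination a 2)) ≤ 1 := by
  have h : Module.finrank k (degreePart (idealOfPoint a) 4) ≤ _ :=
    Submodule.finrank_mono (degreePart_le_range_formCombination 2 2 a)
  have hsum := LinearMap.finrank_range_add_finrank_ker (formCombination a 2)
  rw [Module.finrank_prod, finrank_homogeneousSubmodule] at hsum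
  have hge := nineteen_le_finrank_of_mem_U ha
  have hchoose : (4 + 2 - 1).choose 2 = 10 := rfl
  rw [hchoose] at hsum
  omega

theorem exists_smul_eq_of_finrank_le_one {V : Type*} [AddCommGroup V] [Module k V]
    [FiniteDimensional k V] {K : Submodule k V} (h : Module.finrank k K ≤ 1) :
    ∃ v : V, ∀ w ∈ K, ∃ c : k, c • v = w := by
  obtain ⟨v, hv⟩ := finrank_le_one_iff.mp h
  refine ⟨v, fun w hw => ?_⟩
  obtain ⟨c, hc⟩ := hv ⟨w, hw⟩
  exact ⟨c, congrArg Subtype.val hc⟩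

/-- A relation `A f₀ + B f₁ = 0` between the quadrics of a generic point is a multiple of the
Koszul relation `(f₁, -f₀)`; so it vanishes as soon as `A` and `B` have no term in `X 0 ^ 2`,
provided one of `f₀`, `f₁` has such a term. -/
theorem eq_zero_of_relation (ha : a ∈ U k 4 (fun _ : Fin 2 => 2))
    (hf : ∃ i, coeff (Finsupp.single 0 2) (form a i) ≠ 0) {A B : MvPolynomial (Fin 4) k}
    (hA : A.IsHomogeneous 2) (hB : B.IsHomogeneous 2) (hA0 : A ∈ lowerVarsIdeal k 3)
    (hB0 : B ∈ lowerVarsIdeal k 3) (h : A * form a 0 + B * form a 1 = 0) : A = 0 ∧ B = 0 := by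
  have h0 := form_isHomogeneous a 0
  have h1 := form_isHomogeneous a 1
  obtain ⟨v, hv⟩ := exists_smul_eq_of_finrank_le_one (finrank_ker_formCombination_le ha)
  obtain ⟨s, hs⟩ := hv (⟨form a 1, h1⟩, ⟨-form a 0, h0.neg⟩) (by
    rw [LinearMap.mem_ker, formCombination_apply]; ring)
  obtain ⟨t, ht⟩ := hv (⟨A, hA⟩, ⟨B, hB⟩) (by
    rw [LinearMap.mem_ker, formCombination_apply]; exact h)
  have hs1 : s • v.1.1 = form a 1 := congrArg (fun w => w.1.1) hs
  have hs2 : s • v.2.1 = -form a 0 := congrArg (fun w => w.2.1) hs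
  have ht1 : t • v.1.1 = A := congrArg (fun w => w.1.1) ht
  have ht2 : t • v.2.1 = B := congrArg (fun w => w.2.1) ht
  have hcA := coeff_single_zero_of_mem hA0 2
  have hcB := coeff_single_zero_of_mem hB0 2
  rw [← ht1, coeff_smul, smul_eq_mul] at hcA
  rw [← ht2, coeff_smul, smul_eq_mul] at hcB
  suffices ht0 : t = 0 by
    rw [← ht1, ← ht2, ht0]
    simp
  by_contra ht0
  obtain ⟨i, hi⟩ := hf
  have hv1 := (mul_eq_zero.mp hcA).resolve_left ht0
  have hv2 := (mul_eq_zero.mp hcB).resolve_left ht0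
  fin_cases i
  · apply hi
    have := congrArg (coeff (Finsupp.single 0 2)) hs2
    rw [coeff_smul, hv2, coeff_neg, smul_zero] at this
    simpa using this.symm
  · apply hi
    have := congrArg (coeff (Finsupp.single 0 2)) hs1
    rw [coeff_smul, hv1, smul_zero] at this
    simpa using this.symm

/-- If the initial ideal is lexsegment, the ideal contains no nonzero quartic free of `X 0`:
otherwise all twenty quartic monomials divisible by `X 0`, and one more, would be leading monomials
of quartics in the ideal, whose dimension is at most twenty. -/
theorem eq_zero_of_mem_lowerVars
    (hlex : IsLexsegment (initialIdeal MonomialOrder.lex (idealOfPoint a)))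
    {R : MvPolynomial (Fin 4) k} (hR : R ∈ idealOfPoint a) (hR4 : R.IsHomogeneous 4)
    (hR0 : R ∈ lowerVars k 3) : R = 0 := by
  classical
  by_contra hne
  set r := MonomialOrder.lex.degree R with hr
  have hrsupp : r ∈ R.support := MonomialOrder.degree_mem_support hne
  have hr0 : r 0 = 0 := mem_lowerVars_iff.mp hR0 r hrsupp
  have hrdeg : r.degree = 4 := by
    by_contra h
    exact mem_support_iff.mp hrsupp (hR4.coeff_eq_zero h)
  have hrmem := monomial_degree_mem_initialIdeal MonomialOrder.lex hR hne
  let T : Finset (Fin 4 →₀ ℕ) := ((Finset.univ : Finset (Fin 4)).finsuppAntidiag 3).image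
    (· + Finsupp.single 0 1)
  have hTcard : T.card = 20 := by
    rw [Finset.card_image_of_injective _ (add_left_injective _), card_antidiag]
    rfl
  have hrT : r ∉ T := by
    intro h
    obtain ⟨p, -, hp⟩ := Finset.mem_image.mp h
    have := DFunLike.congr_fun hp 0
    simp [hr0] at this
  have hle := card_le_finrank_degreePart MonomialOrder.lex (I := idealOfPoint a) (e := 4)
    (insert r T) (fun m hm => by
      have hm' : m.degree = 4 ∧ monomial m (1 : k) ∈
          initialIdeal MonomialOrder.lex (idealOfPoint a) := by
        rcases Finset.mem_insert.mp hm with rfl | hm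
        · exact ⟨hrdeg, hrmem⟩
        · obtain ⟨p, hp, rfl⟩ := Finset.mem_image.mp hm
          have hdeg : (p + Finsupp.single 0 1).degree = 4 := by
            simp [mem_antidiag_iff.mp hp]
          refine ⟨hdeg, hlex.2 r _ hrmem (hrdeg.trans hdeg.symm) ?_⟩
          exact (lex_lt_of_apply_zero_lt (by simp [hr0])).le
      have h := exists_degree_eq_of_monomial_mem_initialIdeal _ hm'.2
      rwa [hm'.1] at h)
  rw [Finset.card_insert_of_notMem hrT, hTcard] at hle
  have := finrank_degreePart_four_le (a := a)
  omega

/-- If the initial ideal is lexsegment, `X 0 ^ 2` occurs in one of the two quadrics. -/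
theorem exists_coeff_single_zero_ne_zero (ha : a ∈ U k 4 (fun _ : Fin 2 => 2))
    (hlex : IsLexsegment (initialIdeal MonomialOrder.lex (idealOfPoint a))) :
    ∃ i, coeff (Finsupp.single 0 2) (form a i) ≠ 0 := by
  obtain ⟨i, hi⟩ : ∃ i, form a i ≠ 0 := by
    by_contra! h
    have hge := nineteen_le_finrank_of_mem_U ha
    have hI : idealOfPoint a = ⊥ := Ideal.span_eq_bot.mpr (by rintro _ ⟨i, rfl⟩; exact h i)
    have hbot : degreePart (idealOfPoint a) 4 = ⊥ := by simp [hI, degreePart]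
    rw [hbot, finrank_bot] at hge
    omega
  have hdeg : (MonomialOrder.lex.degree (form a i)).degree = 2 := by
    by_contra h
    exact MonomialOrder.lex.coeff_degree_ne_zero_iff.mpr hi
      ((form_isHomogeneous a i).coeff_eq_zero h)
  have hmem := hlex.2 _ (Finsupp.single 0 2)
    (monomial_degree_mem_initialIdeal MonomialOrder.lex (form_mem_idealOfPoint a i) hi)
    (by simpa using hdeg) (lex_le_single_zero hdeg)
  -- without `X 0 ^ 2` in the quadrics, the ideal lies in `(X 1, X 2, X 3)`, and no power of `X 0`
  -- occurs in any of its elements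
  obtain ⟨g, hg, hg0, hgdeg⟩ := exists_degree_eq_of_monomial_mem_initialIdeal _ hmem
  by_contra! hcoeff
  have hle : idealOfPoint a ≤ lowerVarsIdeal k 3 := by
    refine Ideal.span_le.mpr ?_
    rintro _ ⟨j, rfl⟩
    obtain ⟨l, q, hf, hl, hq, hl', hq'⟩ := exists_eq_quadratic_in_X_zero (form_isHomogeneous a j)
    rw [hcoeff j, C_0, zero_mul, zero_add] at hf
    rw [hf, SetLike.mem_coe]
    exact add_mem
      (Ideal.mul_mem_right _ _ (mem_lowerVarsIdeal_of_isHomogeneous one_ne_zero hl hl'))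
      (mem_lowerVarsIdeal_of_isHomogeneous two_ne_zero hq hq')
  refine MonomialOrder.lex.coeff_degree_ne_zero_iff.mpr hg0 ?_
  rw [hgdeg]
  exact coeff_single_zero_of_mem (hle (mem_degreePart.mp hg).1) 2

end TwoQuadricsInFourVariables

end GenericIdeals

open GenericIdeals in
theorem corollary3p11 (k : Type*) [Field k] [CharZero k] :
    ¬ ∃ a ∈ GenericIdeals.U k 4 (fun _ : Fin 2 => 2),
      GenericIdeals.IsLexsegment
        (GenericIdeals.initialIdeal MonomialOrder.lex (GenericIdeals.idealOfPoint a)) := by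
  rintro ⟨a, ha, hlex⟩
  have hsq := exists_coeff_single_zero_ne_zero ha hlex
  obtain ⟨l₀, q₀, hf₀, hl₀, hq₀, hl₀', hq₀'⟩ :=
    exists_eq_quadratic_in_X_zero (form_isHomogeneous a 0)
  obtain ⟨l₁, q₁, hf₁, hl₁, hq₁, hl₁', hq₁'⟩ :=
    exists_eq_quadratic_in_X_zero (form_isHomogeneous a 1)
  set c₀ := coeff (Finsupp.single 0 2) (form a 0)
  set c₁ := coeff (Finsupp.single 0 2) (form a 1)
  have hc : ¬(c₀ = 0 ∧ c₁ = 0) := by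
    obtain ⟨i, hi⟩ := hsq
    rintro ⟨h₀, h₁⟩
    fin_cases i
    exacts [hi h₀, hi h₁]
  have hI₀ := form_mem_idealOfPoint a 0
  have hI₁ := form_mem_idealOfPoint a 1
  have hX : (X 0 : MvPolynomial (Fin 4) k).IsHomogeneous 1 := isHomogeneous_X k 0
  have hC (c : k) : C c ∈ lowerVars k 3 := Subalgebra.algebraMap_mem _ c
  -- `c₀ f₁ - c₁ f₀ = L X 0 + Q` is the first step of eliminating `X 0`
  set L := C c₀ * l₁ - C c₁ * l₀ with hLdef
  set Q := C c₀ * q₁ - C c₁ * q₀ with hQdef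
  have hL : L.IsHomogeneous 1 := (hl₁.C_mul _).sub (hl₀.C_mul _)
  have hQ : Q.IsHomogeneous 2 := (hq₁.C_mul _).sub (hq₀.C_mul _)
  have hL' : L ∈ lowerVars k 3 := sub_mem (mul_mem (hC _) hl₁') (mul_mem (hC _) hl₀')
  have hQ' : Q ∈ lowerVars k 3 := sub_mem (mul_mem (hC _) hq₁') (mul_mem (hC _) hq₀')
  have hLm := mem_lowerVarsIdeal_of_isHomogeneous one_ne_zero hL hL'
  have hQm := mem_lowerVarsIdeal_of_isHomogeneous two_ne_zero hQ hQ'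
  set A := C c₁ * (L * X 0 - Q) + L * l₁ with hAdef
  set B := -(C c₀ * (L * X 0 - Q) + L * l₀) with hBdef
  have hA : A.IsHomogeneous 2 := (((hL.mul hX).sub hQ).C_mul _).add (hL.mul hl₁)
  have hB : B.IsHomogeneous 2 := ((((hL.mul hX).sub hQ).C_mul _).add (hL.mul hl₀)).neg
  have hAm : A ∈ lowerVarsIdeal k 3 :=
    add_mem (Ideal.mul_mem_left _ _ (sub_mem (Ideal.mul_mem_right _ _ hLm) hQm))
      (Ideal.mul_mem_right _ _ hLm)
  have hBm : B ∈ lowerVarsIdeal k 3 :=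
    neg_mem (add_mem (Ideal.mul_mem_left _ _ (sub_mem (Ideal.mul_mem_right _ _ hLm) hQm))
      (Ideal.mul_mem_right _ _ hLm))
  -- the combination `A f₀ + B f₁` is the resultant of `f₀` and `f₁` with respect to `X 0`
  have hres : A * form a 0 + B * form a 1 = Q ^ 2 - L * (l₀ * q₁ - l₁ * q₀) := by
    rw [hAdef, hBdef, hf₀, hf₁, hLdef, hQdef]
    ring
  have hzero : A * form a 0 + B * form a 1 = 0 := by
    refine eq_zero_of_mem_lowerVars hlex
      (add_mem (Ideal.mul_mem_left _ _ hI₀) (Ideal.mul_mem_left _ _ hI₁))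
      ((hA.mul (form_isHomogeneous a 0)).add (hB.mul (form_isHomogeneous a 1))) ?_
    rw [hres]
    exact sub_mem (pow_mem hQ' 2)
      (mul_mem hL' (sub_mem (mul_mem hl₀' hq₁') (mul_mem hl₁' hq₀')))
  obtain ⟨hA0, hB0⟩ := eq_zero_of_relation ha hsq hA hB hAm hBm hzero
  have hL0 : L = 0 := by
    have : L ^ 2 = C c₀ * A + C c₁ * B := by
      rw [hAdef, hBdef, hLdef]
      ring
    rw [hA0, hB0, mul_zero, mul_zero, add_zero] at this
    exact pow_eq_zero_iff two_ne_zero |>.mp this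
  have hcQ₀ : C c₀ * Q = 0 := by
    have := hB0
    rw [hBdef, hL0] at this
    linear_combination this
  have hcQ₁ : C c₁ * Q = 0 := by
    have := hA0
    rw [hAdef, hL0] at this
    linear_combination -this
  have hQ0 : Q = 0 := by
    by_contra hne
    exact hc ⟨C_eq_zero.mp ((mul_eq_zero.mp hcQ₀).resolve_right hne),
      C_eq_zero.mp ((mul_eq_zero.mp hcQ₁).resolve_right hne)⟩
  have hX1 : (X 1 ^ 2 : MvPolynomial (Fin 4) k).IsHomogeneous 2 := isHomogeneous_X_pow 1 2
  have hX1m : (X 1 ^ 2 : MvPolynomial (Fin 4) k) ∈ lowerVarsIdeal k 3 :=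
    Ideal.pow_mem_of_mem (lowerVarsIdeal k 3) (Ideal.subset_span ⟨1, by simp, rfl⟩) 2 two_pos
  -- now `c₁ f₀ = c₀ f₁`, and multiplying by `X 1 ^ 2`, which has no term in `X 0 ^ 2`,
  -- gives a relation outside the multiples of the Koszul one
  obtain ⟨h₁, h₀⟩ := eq_zero_of_relation ha hsq (A := C (-c₁) * X 1 ^ 2) (B := C c₀ * X 1 ^ 2)
    (hX1.C_mul _) (hX1.C_mul _) (Ideal.mul_mem_left _ _ hX1m) (Ideal.mul_mem_left _ _ hX1m) (by
      rw [hf₀, hf₁, C_neg]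
      linear_combination (X 1 ^ 2 * X 0) * hL0 + X 1 ^ 2 * hQ0)
  have hX1ne : (X 1 ^ 2 : MvPolynomial (Fin 4) k) ≠ 0 := pow_ne_zero _ (X_ne_zero 1)
  exact hc ⟨C_eq_zero.mp ((mul_eq_zero.mp h₀).resolve_right hX1ne),
    neg_eq_zero.mp (C_eq_zero.mp ((mul_eq_zero.mp h₁).resolve_right hX1ne))⟩
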